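/- Let $d$ be a positive integer, let $X \subset \mathbb{R}^d$ be a finite set of unit vectors, and let $\mu$ be a probability distribution on $X$ (points of $X$ may have mass $0$); for $S \subseteq \mathbb{R}^d$ write $\mu(X \cap S) = \sum_{x \in X \cap S} \mu(x)$. Such a pair $(X,\mu)$ is said to lie in isotropic position if $$\sum_{x \in X} \mu(x)\, \frac{\langle x, v\rangle^2}{\|v\|^2} = \frac{1}{d} \qquad \text{for all } v \in \mathbb{R}^d \setminus \{0\}.$$ For an invertible linear map $T : \mathbb{R}^d \to \mathbb{R}^d$, the transformed pair $(X_T, \mu_T)$ is given by $X_T = \{x_T : x \in X\}$ with $x_T = T(x)/\|T(x)\|$, and $\mu_T(x_T) = \mu(x)$ (this is well defined, because $x \mapsto x_T$ is injective on unit vectors). Theorem. There exists an invertible linear map $T : \mathbb{R}^d \to \mathbb{R}^d$ such that $(X_T, \mu_T)$ is in isotropic position if and only if for all integers $0 < k < d$, every $k$-dimensional linear subspace $V \subseteq \mathbb{R}^d$ satisfies either 1. $\mu(X \cap V) < \frac{k}{d}$, or 2. $\mu(X \cap V) = \frac{k}{d}$ and the remaining mass lies in a $(d-k)$-dimensional subspace,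 that is, there is a $(d-k)$-dimensional linear subspace $W \subseteq \mathbb{R}^d$ with $\mu\bigl(X \setminus (V \cup W)\bigr) = 0$. -/

import Mathlib

/-- The normalized image `T x / ‖T x‖` of a point `x` under an invertible linear map `T`. -/
noncomputable def normalizedImage {d : ℕ}
    (T : EuclideanSpace ℝ (Fin d) ≃ₗ[ℝ] EuclideanSpace ℝ (Fin d))
    (x : EuclideanSpace ℝ (Fin d)) : EuclideanSpace ℝ (Fin d) :=
  (‖T x‖)⁻¹ • T x

/-- A pair `(X, μ)`: a finite set `X ⊂ ℝ^d` of unit vectors together with a probability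
distribution `μ` on `X`, given by the masses `μ x` of the points `x ∈ X` (the values of `μ`
outside `X` play no role). -/
structure WeightedPair (d : ℕ) where
  X : Finset (EuclideanSpace ℝ (Fin d))
  μ : EuclideanSpace ℝ (Fin d) → ℝ
  norm_eq_one : ∀ x ∈ X, ‖x‖ = 1
  nonneg : ∀ x ∈ X, 0 ≤ μ x
  sum_eq_one : ∑ x ∈ X, μ x = 1

open scoped Classical in
/-- `μ(X ∩ S)`. -/
noncomputable def WeightedPair.mass {d : ℕ} (P : WeightedPair d)
    (S : Set (EuclideanSpace ℝ (Fin d))) : ℝ :=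
  ∑ x ∈ P.X with x ∈ S, P.μ x

/-- Isotropic position: `∑ x ∈ X, μ x * ⟨x, v⟩ ^ 2 / ‖v‖ ^ 2 = 1 / d` for all `v ≠ 0`. -/
def WeightedPair.IsIsotropic {d : ℕ} (P : WeightedPair d) : Prop :=
  ∀ v : EuclideanSpace ℝ (Fin d), v ≠ 0 →
    ∑ x ∈ P.X, P.μ x * ((inner ℝ x v) ^ 2 / ‖v‖ ^ 2) = 1 / (d : ℝ)

/-- The normalized image of a unit vector is a unit vector. -/
theorem norm_normalizedImage {d : ℕ}
    (T : EuclideanSpace ℝ (Fin d) ≃ₗ[ℝ] EuclideanSpace ℝ (Fin d))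
    {x : EuclideanSpace ℝ (Fin d)} (hx : ‖x‖ = 1) : ‖normalizedImage T x‖ = 1 := by
  have hx0 : x ≠ 0 := by
    intro h
    simp [h] at hx
  have h : ‖T x‖ ≠ 0 := by simpa using hx0
  simp [normalizedImage, norm_smul, h]

open scoped Classical in
/-- The transformed pair `(X_T, μ_T)`, with `X_T = {T x / ‖T x‖ : x ∈ X}` and `μ_T` the image of
`μ` under `x ↦ T x / ‖T x‖`. As this map is injective on unit vectors, `μ_T` is determined by
`μ_T (T x / ‖T x‖) = μ x`: see `WeightedPair.transform_mu`. -/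
noncomputable def WeightedPair.transform {d : ℕ} (P : WeightedPair d)
    (T : EuclideanSpace ℝ (Fin d) ≃ₗ[ℝ] EuclideanSpace ℝ (Fin d)) : WeightedPair d where
  X := P.X.image (normalizedImage T)
  μ y := ∑ x ∈ P.X with normalizedImage T x = y, P.μ x
  norm_eq_one := by
    intro y hy
    obtain ⟨x, hx, rfl⟩ := Finset.mem_image.mp hy
    exact norm_normalizedImage T (P.norm_eq_one x hx)
  nonneg := by
    intro y _
    exact Finset.sum_nonneg fun x hx => P.nonneg x (Finset.mem_filter.mp hx).1
  sum_eq_one := by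
    rw [Finset.sum_fiberwise_of_maps_to (fun x hx => Finset.mem_image_of_mem _ hx)]
    exact P.sum_eq_one

/-- The map `x ↦ T x / ‖T x‖` is injective on unit vectors. -/
theorem normalizedImage_inj {d : ℕ}
    (T : EuclideanSpace ℝ (Fin d) ≃ₗ[ℝ] EuclideanSpace ℝ (Fin d))
    {x y : EuclideanSpace ℝ (Fin d)} (hx : ‖x‖ = 1) (hy : ‖y‖ = 1)
    (h : normalizedImage T x = normalizedImage T y) : x = y := by
  have pos : ∀ z : EuclideanSpace ℝ (Fin d), ‖z‖ = 1 → 0 < ‖T z‖⁻¹ := by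
    intro z hz
    have hz0 : z ≠ 0 := by
      intro h0
      simp [h0] at hz
    have hTz : T z ≠ 0 := by simpa using hz0
    positivity
  have h1 : (‖T x‖)⁻¹ • x = (‖T y‖)⁻¹ • y := by
    apply T.injective
    simpa [normalizedImage] using h
  have h2 : ‖T x‖⁻¹ = ‖T y‖⁻¹ := by
    have h3 := congrArg norm h1
    rwa [norm_smul, norm_smul, hx, hy, mul_one, mul_one, Real.norm_of_nonneg (pos x hx).le,
      Real.norm_of_nonneg (pos y hy).le] at h3
  rw [h2] at h1
  exact smul_right_injective _ (pos y hy).ne' h1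

/-- The defining property of the transformed distribution: `μ_T (T x / ‖T x‖) = μ x`. -/
theorem WeightedPair.transform_mu {d : ℕ} (P : WeightedPair d)
    (T : EuclideanSpace ℝ (Fin d) ≃ₗ[ℝ] EuclideanSpace ℝ (Fin d))
    {x : EuclideanSpace ℝ (Fin d)} (hx : x ∈ P.X) :
    (P.transform T).μ (normalizedImage T x) = P.μ x := by
  simp only [WeightedPair.transform]
  rw [Finset.sum_filter, Finset.sum_eq_single x]
  · rw [if_pos rfl]
  · intro z hz hne
    exact if_neg fun hzx =>
      hne (normalizedImage_inj T (P.norm_eq_one z hz) (P.norm_eq_one x hx) hzx)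
  · intro hn
    exact absurd hx hn

/-! Put `B u v = ⟪T u, T v⟫`: isotropy of the transformed pair says that `d ∑ μ x * B x v ^ 2 / B x
x = B v v` for all `v`, so one looks for an inner product `B`.

Necessity: add the isotropy identity over an orthonormal basis of `U = T V`. The squared lengths of
the projections to `U` of the normalized points then average to `k / d`. Points of `V` contribute
their full mass, so the mass of `V` is at most `k / d`, with equality only if the remaining mass
lies in the preimage of `Uᗮ` (`mass_lt_or_split_of_isIsotropic`).

Sufficiency, with weights `w = d μ`: if every proper nonzero subspace has weight strictly below its
dimension, maximise `log det A - ∑ w i * log ⟪x i, A x i⟫` over positive definite `A`. Stationarity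
along rank-one perturbations is the isotropy identity for `⟪u, A v⟫`
(`sum_inner_sq_div_eq_of_isMax`). A maximum exists because the functional is scale invariant and
tends to `-∞` with the condition number (`exists_log_eigenvalues_sub_le`): by compactness the strict
inequalities have a uniform gap, which summation by parts over the ordered eigenvalues turns into a
bound. If some subspace is tight, the points split between it and a complement; both parts inherit
the condition, and induction on dimension gives forms whose direct sum works. -/

/-- Summation by parts for an antitone sequence against coefficients whose proper partial sums are
at most `-ε`. -/
theorem sum_mul_le_of_partial_sums_le {l c : ℕ → ℝ} {ε : ℝ} (n : ℕ)
    (hl : ∀ k < n, l (k + 1) ≤ l k)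
    (hc : ∀ k, 0 < k → k ≤ n → ∑ j ∈ Finset.range k, c j ≤ -ε) :
    ∑ j ∈ Finset.range (n + 1), c j * l j ≤
      (∑ j ∈ Finset.range (n + 1), c j) * l n - ε * (l 0 - l n) := by
  induction n with
  | zero => simp
  | succ n ih =>
    have h1 := ih (fun k hk => hl k (by omega)) (fun k h0 hk => hc k h0 (by omega))
    rw [Finset.sum_range_succ, Finset.sum_range_succ c (n + 1)]
    have h2 := hc (n + 1) (by omega) le_rfl
    have h3 := hl n (by omega)
    nlinarith [mul_nonneg (sub_nonneg.2 h2) (sub_nonneg.2 h3)]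

/-! ### Compactness of orthonormal frames and a uniform gap in the subspace condition -/

section Coercivity

variable {E : Type*} [NormedAddCommGroup E] [InnerProductSpace ℝ E] [FiniteDimensional ℝ E]
variable {ι : Type*} [Fintype ι]

open scoped Classical in
/-- The total weight of the points `x i` that lie in `V`. -/
noncomputable def weightIn {F : Type*} [AddCommGroup F] [Module ℝ F]
    (x : ι → F) (w : ι → ℝ) (V : Submodule ℝ F) : ℝ :=
  ∑ i with x i ∈ V, w i

theorem isCompact_setOf_orthonormal (n : ℕ) : IsCompact {e : Fin n → E | Orthonormal ℝ e} := by
  have hE : ProperSpace E := FiniteDimensional.proper ℝ E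
  refine Metric.isCompact_of_isClosed_isBounded ?_ ?_
  · simp only [orthonormal_iff_ite, Set.ofPred_forall]
    refine isClosed_iInter fun i => isClosed_iInter fun j => ?_
    exact isClosed_eq (by fun_prop) (by fun_prop)
  · refine (Metric.isBounded_closedBall (x := (0 : Fin n → E)) (r := 1)).subset fun e he => ?_
    rw [mem_closedBall_zero_iff, pi_norm_le_iff_of_nonneg zero_le_one]
    exact fun i => (he.1 i).le

/-- A set of points of large total weight stays away from the orthogonal complement of the
first `k` vectors of an orthonormal frame. -/
theorem weight_lt_or_exists_pos_le_sum_inner_sq {n : ℕ} (hn : Module.finrank ℝ E = n)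
    {x : ι → E} {w : ι → ℝ} (hw : ∀ i, 0 < w i)
    (hV : ∀ V : Submodule ℝ E, V ≠ ⊥ → V ≠ ⊤ → weightIn x w V < Module.finrank ℝ V)
    (S : Finset ι) {k : ℕ} (hk0 : 0 < k) (hk : k < n) :
    ∑ i ∈ S, w i < (n : ℝ) - k ∨
      ∃ c > 0, ∀ b : OrthonormalBasis (Fin n) ℝ E,
        c ≤ ∑ i ∈ S, ∑ j : Fin n with j.1 < k, (inner ℝ (b j) (x i)) ^ 2 := by
  have b₀ : OrthonormalBasis (Fin n) ℝ E := (stdOrthonormalBasis ℝ E).reindex (finCongr hn)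
  -- If the minimum over frames is zero, the points of `S` lie in the `(n - k)`-dimensional
  -- complement of the first `k` vectors; otherwise the minimum serves as `c`.
  obtain ⟨e, he, hmin⟩ := (isCompact_setOf_orthonormal (E := E) n).exists_isMinOn
    ⟨b₀, b₀.orthonormal⟩
    (f := fun e => ∑ i ∈ S, ∑ j : Fin n with j.1 < k, (inner ℝ (e j) (x i)) ^ 2)
    (by fun_prop)
  rcases (Finset.sum_nonneg fun i (_ : i ∈ S) => Finset.sum_nonneg
    fun (j : Fin n) (_ : j ∈ Finset.univ.filter fun j : Fin n => j.1 < k) =>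
      sq_nonneg (inner ℝ (e j) (x i))).eq_or_lt with h0 | hpos
  · left
    set U : Submodule ℝ E := Submodule.span ℝ (Set.range fun j : Fin k => e (Fin.castLE hk.le j))
    have hU : Module.finrank ℝ U = k := by
      have := finrank_span_eq_card (R := ℝ) (b := fun j : Fin k => e (Fin.castLE hk.le j))
        ((he.linearIndependent).comp _ (Fin.castLE_injective hk.le))
      simpa using this
    have hUo : Module.finrank ℝ Uᗮ = n - k := by
      have := U.finrank_add_finrank_orthogonal
      omega
    have hS : ∀ i ∈ S, x i ∈ Uᗮ := by
      intro i hi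
      have h2 := (Finset.sum_eq_zero_iff_of_nonneg fun i _ =>
        Finset.sum_nonneg fun _ _ => sq_nonneg _).1 h0.symm i hi
      have h3 : U ≤ (Submodule.span ℝ {x i})ᗮ := by
        refine Submodule.span_le.2 ?_
        rintro _ ⟨j, rfl⟩
        refine Submodule.mem_orthogonal_singleton_iff_inner_left.2 ?_
        exact pow_eq_zero_iff two_ne_zero |>.1 <|
          (Finset.sum_eq_zero_iff_of_nonneg fun _ _ => sq_nonneg _).1 h2 (Fin.castLE hk.le j)
            (by simp)
      exact (Submodule.mem_orthogonal U _).2 fun u hu =>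
        Submodule.mem_orthogonal_singleton_iff_inner_left.1 (h3 hu)
    have h1 : weightIn x w Uᗮ < Module.finrank ℝ Uᗮ := by
      refine hV _ ?_ ?_
      · intro h
        rw [h, finrank_bot] at hUo
        omega
      · intro h
        rw [h, finrank_top] at hUo
        omega
    rw [hUo, Nat.cast_sub hk.le] at h1
    refine lt_of_le_of_lt ?_ h1
    refine Finset.sum_le_sum_of_subset_of_nonneg (fun i hi => by simpa using hS i hi)
      fun i _ _ => (hw i).le
  · exact Or.inr ⟨_, hpos, fun b => hmin b.orthonormal⟩

/-- Strictness in the subspace condition is uniform over orthonormal frames. -/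
theorem exists_uniform_weight_gap {n : ℕ} (hn : Module.finrank ℝ E = n)
    {x : ι → E} {w : ι → ℝ} (hw : ∀ i, 0 < w i)
    (hV : ∀ V : Submodule ℝ E, V ≠ ⊥ → V ≠ ⊤ → weightIn x w V < Module.finrank ℝ V) :
    ∃ δ > 0, ∃ ε > 0, ∀ b : OrthonormalBasis (Fin n) ℝ E, ∀ S : Finset ι, ∀ k : ℕ, 0 < k → k < n →
      (∀ i ∈ S, ∀ j : Fin n, j.1 < k → (inner ℝ (b j) (x i)) ^ 2 < δ) →
      ∑ i ∈ S, w i ≤ (n : ℝ) - k - ε := by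
  -- For fixed `S` and `k` one number serves as both threshold and gap; there are finitely many such
  -- pairs, so the minimum is uniform.
  have key : ∀ p : Finset ι × Fin n, ∃ η > 0, ∀ b : OrthonormalBasis (Fin n) ℝ E, 0 < p.2.1 →
      (∀ i ∈ p.1, ∀ j : Fin n, j.1 < p.2.1 → (inner ℝ (b j) (x i)) ^ 2 < η) →
      ∑ i ∈ p.1, w i ≤ (n : ℝ) - p.2.1 - η := by
    rintro ⟨S, k, hk⟩
    rcases Nat.eq_zero_or_pos k with rfl | hk0
    · exact ⟨1, one_pos, fun _ h => absurd h (lt_irrefl _)⟩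
    rcases weight_lt_or_exists_pos_le_sum_inner_sq hn hw hV S hk0 hk with h | ⟨c, hc, h⟩
    · exact ⟨(n : ℝ) - k - ∑ i ∈ S, w i, by linarith, fun _ _ _ => by simp⟩
    -- At most `S.card * n` squares below this threshold add up to less than `c`; the `+ 1` makes
    -- this strict.
    · refine ⟨c / (S.card * n + 1), by positivity, fun b _ hb => ?_⟩
      exfalso
      have h1 : ∑ i ∈ S, ∑ j : Fin n with j.1 < k, (inner ℝ (b j) (x i)) ^ 2 ≤
          ∑ i ∈ S, ∑ j : Fin n, c / (S.card * n + 1) := by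
        refine Finset.sum_le_sum fun i hi => ?_
        refine (Finset.sum_le_sum fun j hj => (hb i hi j (by simpa using hj)).le).trans ?_
        exact Finset.sum_le_sum_of_subset_of_nonneg (Finset.filter_subset _ _)
          fun _ _ _ => by positivity
      have h2 := (h b).trans h1
      simp only [Finset.sum_const, Finset.card_univ, Fintype.card_fin, nsmul_eq_mul] at h2
      have h3 : (S.card : ℝ) * (n * (c / (S.card * n + 1))) < c := by
        rw [← mul_assoc, mul_div_assoc', div_lt_iff₀ (by positivity)]
        nlinarith
      linarith
  choose η hη hb using key
  obtain ⟨δ, hδ, hle⟩ : ∃ δ > 0, ∀ p, δ ≤ η p := by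
    rcases isEmpty_or_nonempty (Finset ι × Fin n) with h | h
    · exact ⟨1, one_pos, fun p => h.elim p⟩
    · obtain ⟨p, hp⟩ := Finite.exists_min η
      exact ⟨η p, hη p, hp⟩
  refine ⟨δ, hδ, δ, hδ, fun b S k hk0 hk h => ?_⟩
  have := hb (S, ⟨k, hk⟩) b hk0 fun i hi j hj => (h i hi j hj).trans_le (hle _)
  have h2 := hle (S, ⟨k, hk⟩)
  dsimp only at this
  linarith

end Coercivity

/-! ### Existence of a maximiser of the log-determinant functional and its first-order condition -/

section Maximiser

variable {E : Type*} [NormedAddCommGroup E] [InnerProductSpace ℝ E]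
variable {ι : Type*} [Fintype ι]

/-- Symmetric positive definite operators on a real inner product space. -/
def IsPosDefOperator (A : E →L[ℝ] E) : Prop :=
  (A : E →ₗ[ℝ] E).IsSymmetric ∧ ∀ v, v ≠ 0 → 0 < inner ℝ v (A v)

/-- The functional whose maximisers on positive definite operators give isotropic position. -/
noncomputable def logDetRatio (x : ι → E) (w : ι → ℝ) (A : E →L[ℝ] E) : ℝ :=
  Real.log A.det - ∑ i, w i * Real.log (inner ℝ (x i) (A (x i)))

theorem IsPosDefOperator.smul {A : E →L[ℝ] E} (hA : IsPosDefOperator A) {t : ℝ} (ht : 0 < t) :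
    IsPosDefOperator (t • A) := by
  refine ⟨fun u v => ?_, fun v hv => ?_⟩
  · have := hA.1 u v
    simp only [ContinuousLinearMap.coe_coe] at this
    simp [real_inner_smul_left, real_inner_smul_right, this]
  · have := hA.2 v hv
    simp only [smul_apply, real_inner_smul_right]
    positivity

theorem logDetRatio_one {x : ι → E} {w : ι → ℝ} (hx : ∀ i, ‖x i‖ = 1) :
    logDetRatio x w 1 = 0 := by
  have : (1 : E →L[ℝ] E).det = 1 := by simp [ContinuousLinearMap.det]
  simp [logDetRatio, hx, this]

variable [FiniteDimensional ℝ E]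

theorem LinearMap.IsSymmetric.inner_apply_self_eq_sum {n : ℕ} {A : E →ₗ[ℝ] E}
    (hA : A.IsSymmetric) (hn : Module.finrank ℝ E = n) (v : E) :
    inner ℝ v (A v) =
      ∑ j, hA.eigenvalues hn j * (inner ℝ (hA.eigenvectorBasis hn j) v) ^ 2 := by
  rw [← (hA.eigenvectorBasis hn).sum_inner_mul_inner v (A v)]
  refine Finset.sum_congr rfl fun j _ => ?_
  have h := hA.eigenvectorBasis_apply_self_apply hn v j
  rw [OrthonormalBasis.repr_apply_apply, OrthonormalBasis.repr_apply_apply] at h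
  rw [h, real_inner_comm]
  simp only [RCLike.ofReal_real_eq_id, id_eq]
  ring

theorem IsPosDefOperator.eigenvalues_pos {n : ℕ} {A : E →L[ℝ] E} (hA : IsPosDefOperator A)
    (hn : Module.finrank ℝ E = n) (j : Fin n) : 0 < hA.1.eigenvalues hn j := by
  have h1 := hA.2 (hA.1.eigenvectorBasis hn j) ((hA.1.eigenvectorBasis hn).orthonormal.ne_zero j)
  have h2 := hA.1.apply_eigenvectorBasis hn j
  rw [ContinuousLinearMap.coe_coe] at h2
  rw [h2, real_inner_smul_right, real_inner_self_eq_norm_sq,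
    (hA.1.eigenvectorBasis hn).orthonormal.1 j] at h1
  simpa using h1

theorem IsPosDefOperator.det_eq_prod {n : ℕ} {A : E →L[ℝ] E} (hA : IsPosDefOperator A)
    (hn : Module.finrank ℝ E = n) : A.det = ∏ j, hA.1.eigenvalues hn j := by
  have := hA.1.det_eq_prod_eigenvalues hn
  simpa using this

theorem IsPosDefOperator.det_pos {A : E →L[ℝ] E} (hA : IsPosDefOperator A) : 0 < A.det := by
  rw [hA.det_eq_prod rfl]
  exact Finset.prod_pos fun j _ => hA.eigenvalues_pos rfl j

theorem logDetRatio_smul {x : ι → E} {w : ι → ℝ} (hx : ∀ i, ‖x i‖ = 1)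
    (hsum : ∑ i, w i = Module.finrank ℝ E) {A : E →L[ℝ] E} (hA : IsPosDefOperator A) {t : ℝ}
    (ht : 0 < t) : logDetRatio x w (t • A) = logDetRatio x w A := by
  have hdet : (t • A).det = t ^ Module.finrank ℝ E * A.det := by
    simp [ContinuousLinearMap.det]
  have hq : ∀ i, Real.log (inner ℝ (x i) ((t • A) (x i))) =
      Real.log t + Real.log (inner ℝ (x i) (A (x i))) := by
    intro i
    have := hA.2 (x i) (norm_ne_zero_iff.1 (by simp [hx]))
    rw [smul_apply, real_inner_smul_right, Real.log_mul ht.ne' this.ne']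
  unfold logDetRatio
  rw [hdet, Real.log_mul (by positivity) hA.det_pos.ne', Real.log_pow]
  simp only [hq, mul_add, Finset.sum_add_distrib, ← Finset.sum_mul, hsum]
  ring

theorem exists_first_index {n : ℕ} {p : Fin n → Prop} (h : ∃ j, p j) :
    ∃ j, p j ∧ ∀ k < j, ¬ p k := by
  obtain ⟨j, hj, hmin⟩ := wellFounded_lt.has_min {j | p j} h
  exact ⟨j, hj, fun k hk hp => hmin k hp hk⟩

/-- Operators at which the functional is at least `0` have bounded condition number. -/
theorem exists_log_eigenvalues_sub_le {m : ℕ} (hn : Module.finrank ℝ E = m + 1)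
    {x : ι → E} {w : ι → ℝ} (hx : ∀ i, ‖x i‖ = 1) (hw : ∀ i, 0 < w i)
    (hsum : ∑ i, w i = Module.finrank ℝ E)
    (hV : ∀ V : Submodule ℝ E, V ≠ ⊥ → V ≠ ⊤ → weightIn x w V < Module.finrank ℝ V) :
    ∃ R : ℝ, ∀ A : E →L[ℝ] E, ∀ hA : IsPosDefOperator A, 0 ≤ logDetRatio x w A →
      Real.log (hA.1.eigenvalues hn 0) - Real.log (hA.1.eigenvalues hn (Fin.last m)) ≤ R := by
  obtain ⟨δ₀, hδ₀, ε, hε, hgap⟩ := exists_uniform_weight_gap hn hw hV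
  -- The `m + 1` squared coordinates of a unit vector sum to 1, so they cannot all be below `1 / (m
  -- + 2)`.
  set δ := min δ₀ (1 / (m + 2)) with hδ_def
  have hδ : 0 < δ := lt_min hδ₀ (by positivity)
  refine ⟨-((m + 1) * Real.log δ) / ε, fun A hA hF => ?_⟩
  set b := hA.1.eigenvectorBasis hn
  set lam := hA.1.eigenvalues hn
  have hlam : ∀ j, 0 < lam j := hA.eigenvalues_pos hn
  have hex : ∀ i, ∃ j, δ ≤ (inner ℝ (b j) (x i)) ^ 2 := by
    intro i
    by_contra! h
    have h1 := b.sum_sq_norm_inner_right (x i)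
    simp only [hx, Real.norm_eq_abs, sq_abs] at h1
    have h2 : ∑ j, (inner ℝ (b j) (x i)) ^ 2 ≤ ∑ _j : Fin (m + 1), δ :=
      Finset.sum_le_sum fun j _ => (h j).le
    have h3 : δ ≤ 1 / (m + 2) := min_le_right _ _
    rw [le_div_iff₀ (by positivity)] at h3
    simp at h2
    nlinarith
  -- `J i` is the direction of largest eigenvalue in which `x i` has a non-negligible component.
  -- Points with `J i ≥ k` are nearly orthogonal to the first `k` eigenvectors, so the gap bounds
  -- their weight.
  choose J hJ hJmin using fun i => exists_first_index (hex i)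
  let l : ℕ → ℝ := fun k => if h : k < m + 1 then Real.log (lam ⟨k, h⟩) else 0
  have hl : ∀ j : Fin (m + 1), l j = Real.log (lam j) := fun j => by simp [l, j.is_lt, -Order.lt_add_one_iff]
  -- With these coefficients `∑ c j * l j` is the functional with each `⟪x i, A x i⟫` replaced by
  -- the eigenvalue at `J i`, an error of at most `-(m + 1) * log δ`.
  let c : ℕ → ℝ := fun k => 1 - ∑ i, if (J i : ℕ) = k then w i else 0
  have hcsum : ∀ k, ∑ j ∈ Finset.range k, c j = k - ∑ i with (J i : ℕ) < k, w i := by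
    intro k
    simp only [c, Finset.sum_sub_distrib]
    rw [Finset.sum_comm, Finset.sum_filter]
    simp
  have hsum' : ∑ i, w i = m + 1 := by rw [hsum, hn]; push_cast; rfl
  have hparts := sum_mul_le_of_partial_sums_le (l := l) (c := c) (ε := ε) m
    (by
      intro k hk
      have h1 := hl ⟨k, by omega⟩
      have h2 := hl ⟨k + 1, by omega⟩
      dsimp only at h1 h2
      rw [h1, h2]
      exact Real.log_le_log (hlam _) (hA.1.eigenvalues_antitone hn (by simp [Fin.le_def])))
    (by
      intro k hk0 hk
      have h1 := hgap b {i | ¬ (J i : ℕ) < k} k hk0 (by omega) (by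
        intro i hi j hj
        have hi' : k ≤ J i := by simpa using hi
        exact (not_le.1 (hJmin i j (by rw [Fin.lt_def]; omega))).trans_le (min_le_left _ _))
      have h2 := Finset.sum_filter_add_sum_filter_not Finset.univ (fun i => (J i : ℕ) < k) w
      rw [hcsum]
      push_cast at h1
      linarith)
  have hctot : ∑ j ∈ Finset.range (m + 1), c j = 0 := by
    rw [hcsum, Finset.filter_true_of_mem fun i _ => (J i).is_lt, hsum']
    simp
  have hcl : ∑ j ∈ Finset.range (m + 1), c j * l j =
      ∑ j, Real.log (lam j) - ∑ i, w i * Real.log (lam (J i)) := by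
    simp only [c, sub_mul, one_mul, Finset.sum_sub_distrib, Finset.sum_mul, ite_mul, zero_mul]
    rw [Finset.sum_comm, Finset.sum_range]
    simp [hl, Fin.is_lt, -Order.lt_add_one_iff]
  have hq : ∀ i, Real.log (lam (J i)) + Real.log δ ≤ Real.log (inner ℝ (x i) (A (x i))) := by
    intro i
    rw [← Real.log_mul (hlam _).ne' hδ.ne']
    refine Real.log_le_log (mul_pos (hlam _) hδ) ?_
    have h1 := hA.1.inner_apply_self_eq_sum hn (x i)
    rw [ContinuousLinearMap.coe_coe] at h1
    rw [h1]
    refine (mul_le_mul_of_nonneg_left (hJ i) (hlam _).le).trans ?_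
    exact Finset.single_le_sum (f := fun j => lam j * (inner ℝ (b j) (x i)) ^ 2)
      (fun j _ => mul_nonneg (hlam j).le (sq_nonneg _)) (Finset.mem_univ _)
  have hFle : logDetRatio x w A ≤
      ∑ j, Real.log (lam j) - ∑ i, w i * Real.log (lam (J i)) - (m + 1) * Real.log δ := by
    unfold logDetRatio
    rw [hA.det_eq_prod hn, Real.log_prod fun j _ => (hlam j).ne']
    have h1 : ∑ i, w i * (Real.log (lam (J i)) + Real.log δ) ≤
        ∑ i, w i * Real.log (inner ℝ (x i) (A (x i))) :=
      Finset.sum_le_sum fun i _ => mul_le_mul_of_nonneg_left (hq i) (hw i).le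
    simp only [mul_add, Finset.sum_add_distrib, ← Finset.sum_mul, hsum'] at h1
    linarith
  rw [le_div_iff₀ hε]
  have h0 := hl 0
  have hm := hl (Fin.last m)
  simp only [Fin.val_zero, Fin.val_last] at h0 hm
  rw [hcl, hctot, h0, hm] at hparts
  linarith

theorem exists_uniform_ellipticity {m : ℕ} (hn : Module.finrank ℝ E = m + 1)
    {x : ι → E} {w : ι → ℝ} (hx : ∀ i, ‖x i‖ = 1) (hw : ∀ i, 0 < w i)
    (hsum : ∑ i, w i = Module.finrank ℝ E)
    (hV : ∀ V : Submodule ℝ E, V ≠ ⊥ → V ≠ ⊤ → weightIn x w V < Module.finrank ℝ V) :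
    ∃ r > 0, ∀ A : E →L[ℝ] E, IsPosDefOperator A → 0 ≤ logDetRatio x w A →
      ∃ t : ℝ, 0 < t ∧ ∀ v, r * ‖v‖ ^ 2 ≤ inner ℝ v ((t • A) v) ∧ inner ℝ v ((t • A) v) ≤ ‖v‖ ^ 2 := by
  obtain ⟨R, hR⟩ := exists_log_eigenvalues_sub_le hn hx hw hsum hV
  refine ⟨Real.exp (-R), Real.exp_pos _, fun A hA hF => ?_⟩
  set lam := hA.1.eigenvalues hn with hlam_def
  have hlam : ∀ j, 0 < lam j := hA.eigenvalues_pos hn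
  -- Eigenvalues are in decreasing order, so this scales the largest one to 1.
  refine ⟨(lam 0)⁻¹, inv_pos.2 (hlam 0), fun v => ?_⟩
  have h1 := hA.1.inner_apply_self_eq_sum hn v
  rw [ContinuousLinearMap.coe_coe] at h1
  have h2 := (hA.1.eigenvectorBasis hn).sum_sq_norm_inner_right v
  simp only [Real.norm_eq_abs, sq_abs] at h2
  rw [smul_apply, real_inner_smul_right, h1, ← h2, Finset.mul_sum,
    Finset.mul_sum]
  have hratio : Real.exp (-R) ≤ (lam 0)⁻¹ * lam (Fin.last m) := by
    rw [← Real.log_le_log_iff (Real.exp_pos _) (mul_pos (inv_pos.2 (hlam 0)) (hlam _)),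
      Real.log_exp, Real.log_mul (inv_pos.2 (hlam 0)).ne' (hlam _).ne', Real.log_inv]
    linarith [hR A hA hF]
  constructor
  · refine Finset.sum_le_sum fun j _ => ?_
    rw [← mul_assoc]
    refine mul_le_mul_of_nonneg_right (hratio.trans ?_) (sq_nonneg _)
    exact mul_le_mul_of_nonneg_left (hA.1.eigenvalues_antitone hn (Fin.le_last j))
      (inv_pos.2 (hlam 0)).le
  · refine Finset.sum_le_sum fun j _ => ?_
    rw [← mul_assoc]
    refine mul_le_of_le_one_left (sq_nonneg _) ?_
    rw [inv_mul_le_iff₀ (hlam 0), mul_one]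
    exact hA.1.eigenvalues_antitone hn (Fin.zero_le j)

theorem isCompact_setOf_elliptic (r : ℝ) (hr : 0 < r) :
    IsCompact {A : E →L[ℝ] E | (∀ u v, inner ℝ (A u) v = inner ℝ u (A v)) ∧
      ∀ v, r * ‖v‖ ^ 2 ≤ inner ℝ v (A v) ∧ inner ℝ v (A v) ≤ ‖v‖ ^ 2} := by
  have hP : ProperSpace (E →L[ℝ] E) := FiniteDimensional.proper ℝ _
  refine Metric.isCompact_of_isClosed_isBounded ?_ ?_
  · simp only [Set.ofPred_and, Set.ofPred_forall]
    refine IsClosed.inter ?_ ?_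
    · refine isClosed_iInter fun u => isClosed_iInter fun v => ?_
      exact isClosed_eq (by fun_prop) (by fun_prop)
    · refine isClosed_iInter fun v => ?_
      exact IsClosed.inter (isClosed_le (by fun_prop) (by fun_prop))
        (isClosed_le (by fun_prop) (by fun_prop))
  · refine (Metric.isBounded_closedBall (x := (0 : E →L[ℝ] E)) (r := 1)).subset fun A hA => ?_
    rw [mem_closedBall_zero_iff]
    refine A.opNorm_le_of_unit_norm zero_le_one fun u hu => ?_
    -- Polarisation: the values of the form at `u + A u` and `u - A u` differ by `4 * ‖A u‖ ^ 2`,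
    -- whence `4 * ‖A u‖ ^ 2 ≤ (1 + ‖A u‖) ^ 2` and `‖A u‖ ≤ 1`.
    have h1 := (hA.2 (u + A u)).2
    have h2 := (hA.2 (u - A u)).1
    have h3 := hA.1 u (A u)
    have h4 : 0 ≤ r * ‖u - A u‖ ^ 2 := by positivity
    have h5 : ‖u + A u‖ ≤ 1 + ‖A u‖ := by simpa [hu] using norm_add_le u (A u)
    have h6 : ‖u + A u‖ ^ 2 ≤ (1 + ‖A u‖) ^ 2 := by gcongr
    simp only [map_add, map_sub, inner_add_left, inner_add_right, inner_sub_left,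
      inner_sub_right, ← h3, real_inner_self_eq_norm_sq] at h1 h2
    nlinarith [norm_nonneg (A u)]

/-- Under the strict subspace condition the functional attains its maximum. -/
theorem exists_maximiser {m : ℕ} (hn : Module.finrank ℝ E = m + 1)
    {x : ι → E} {w : ι → ℝ} (hx : ∀ i, ‖x i‖ = 1) (hw : ∀ i, 0 < w i)
    (hsum : ∑ i, w i = Module.finrank ℝ E)
    (hV : ∀ V : Submodule ℝ E, V ≠ ⊥ → V ≠ ⊤ → weightIn x w V < Module.finrank ℝ V) :
    ∃ r > 0, ∃ A : E →L[ℝ] E, IsPosDefOperator A ∧ (∀ v, r * ‖v‖ ^ 2 ≤ inner ℝ v (A v)) ∧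
      ∀ A', IsPosDefOperator A' → logDetRatio x w A' ≤ logDetRatio x w A := by
  obtain ⟨r, hr, hell⟩ := exists_uniform_ellipticity hn hx hw hsum hV
  set K := {A : E →L[ℝ] E | (∀ u v, inner ℝ (A u) v = inner ℝ u (A v)) ∧
      ∀ v, r * ‖v‖ ^ 2 ≤ inner ℝ v (A v) ∧ inner ℝ v (A v) ≤ ‖v‖ ^ 2} with hK
  have hKpos : ∀ A ∈ K, IsPosDefOperator A := fun A hA =>
    ⟨hA.1, fun v hv => lt_of_lt_of_le (by positivity) (hA.2 v).1⟩
  have hscale : ∀ A, IsPosDefOperator A → 0 ≤ logDetRatio x w A →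
      ∃ A' ∈ K, logDetRatio x w A' = logDetRatio x w A := by
    intro A hA hF
    obtain ⟨t, ht, h⟩ := hell A hA hF
    exact ⟨t • A, ⟨fun u v => (hA.smul ht).1 u v, h⟩, logDetRatio_smul hx hsum hA ht⟩
  have hone : IsPosDefOperator (1 : E →L[ℝ] E) :=
    ⟨fun u v => rfl, fun v hv => by simpa using pow_pos (norm_pos_iff.2 hv) 2⟩
  -- A rescaled identity gives value 0 on `K`. Operators with negative value thus cannot compete,
  -- and all others rescale into `K`, so a maximum over `K` is global.
  obtain ⟨A₁, hA₁, hF₁⟩ := hscale 1 hone (logDetRatio_one hx).ge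
  have hcont : ContinuousOn (logDetRatio x w) K := by
    unfold logDetRatio
    refine ContinuousOn.sub ?_ (continuousOn_finsetSum _ fun i _ => ?_)
    · exact ContinuousLinearMap.continuous_det.continuousOn.log
        fun A hA => (hKpos A hA).det_pos.ne'
    · refine continuousOn_const.mul (ContinuousOn.log (by fun_prop) fun A hA => ?_)
      exact ((hKpos A hA).2 (x i) (norm_ne_zero_iff.1 (by simp [hx]))).ne'
  obtain ⟨A, hA, hmax⟩ := (isCompact_setOf_elliptic r hr).exists_isMaxOn ⟨A₁, hA₁⟩ hcont
  have h0 : 0 ≤ logDetRatio x w A := by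
    rw [← logDetRatio_one (x := x) (w := w) hx, ← hF₁]
    exact hmax hA₁
  refine ⟨r, hr, A, hKpos A hA, fun v => (hA.2 v).1, fun A' hA' => ?_⟩
  rcases lt_or_ge (logDetRatio x w A') 0 with h | h
  · exact h.le.trans h0
  · obtain ⟨A'', hA'', hF⟩ := hscale A' hA' h
    rw [← hF]
    exact hmax hA''

/-- The first-order condition at a maximiser, in the direction of a rank-one perturbation. -/
theorem sum_inner_sq_div_eq_of_isMax {x : ι → E} {w : ι → ℝ} (hx : ∀ i, ‖x i‖ = 1)
    {A : E →L[ℝ] E} (hA : IsPosDefOperator A) {r : ℝ} (hr : 0 < r)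
    (hAr : ∀ v, r * ‖v‖ ^ 2 ≤ inner ℝ v (A v))
    (hmax : ∀ A', IsPosDefOperator A' → logDetRatio x w A' ≤ logDetRatio x w A) (v : E) :
    ∑ i, w i * ((inner ℝ (x i) (A v)) ^ 2 / inner ℝ (x i) (A (x i))) = inner ℝ v (A v) := by
  set u := A v with hu
  let R : E →L[ℝ] E := (innerSL ℝ u).smulRight u
  have hR : ∀ z, R z = inner ℝ u z • u := fun z => by simp [R]
  have hq : ∀ i, 0 < inner ℝ (x i) (A (x i)) :=
    fun i => hA.2 (x i) (norm_ne_zero_iff.1 (by simp [hx]))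
  -- Since `u = A v`, the perturbed operator is `A` composed with the transvection `z ↦ z + ⟪u, z⟫ •
  -- (s • v)`, whose determinant is explicit.
  have hdet : ∀ s : ℝ, (A + s • R).det = A.det * (1 + s * inner ℝ v u) := by
    intro s
    have h1 : ((A + s • R : E →L[ℝ] E) : E →ₗ[ℝ] E) = (A : E →ₗ[ℝ] E) ∘ₗ
        LinearMap.transvection (innerSL ℝ u : E →ₗ[ℝ] ℝ) (s • v) := by
      ext z
      simp [LinearMap.transvection.apply, hR, hu, smul_smul, mul_comm]
    unfold ContinuousLinearMap.det
    rw [h1, LinearMap.det_comp, LinearMap.transvection.det]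
    simp [real_inner_comm]
  have hform : ∀ (s : ℝ) z, inner ℝ z ((A + s • R) z) =
      inner ℝ z (A z) + s * (inner ℝ z u) ^ 2 := by
    intro s z
    simp only [add_apply, smul_apply, hR, inner_add_right,
      real_inner_smul_right, real_inner_comm z u]
    ring
  have hpd : ∀ᶠ s : ℝ in nhds 0, IsPosDefOperator (A + s • R) := by
    have h1 : ∀ᶠ s : ℝ in nhds 0, |s| * ‖u‖ ^ 2 < r := by
      have : Filter.Tendsto (fun s : ℝ => |s| * ‖u‖ ^ 2) (nhds 0) (nhds (|0| * ‖u‖ ^ 2)) :=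
        Continuous.tendsto (by fun_prop) 0
      refine this.eventually_lt_const ?_
      simpa using hr
    filter_upwards [h1] with s hs
    refine ⟨fun y z => ?_, fun z hz => ?_⟩
    · have h2 := hA.1 y z
      simp only [ContinuousLinearMap.coe_coe] at h2
      simp only [ContinuousLinearMap.coe_coe, add_apply,
        smul_apply, hR, inner_add_left, inner_add_right, real_inner_smul_left,
        real_inner_smul_right, h2, real_inner_comm y u]
      ring
    · rw [hform]
      have h2 : (inner ℝ z u) ^ 2 ≤ (‖z‖ * ‖u‖) ^ 2 := by
        rw [← sq_abs]
        gcongr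
        exact abs_real_inner_le_norm z u
      have h3 : |s| * (inner ℝ z u) ^ 2 ≤ |s| * (‖z‖ * ‖u‖) ^ 2 := by gcongr
      have h4 : |s| * ‖u‖ ^ 2 * ‖z‖ ^ 2 < r * ‖z‖ ^ 2 := by gcongr
      have h5 := mul_le_mul_of_nonneg_right (neg_abs_le s) (sq_nonneg (inner ℝ z u))
      have := hAr z
      nlinarith
  have hlocal : IsLocalMax (fun s : ℝ => Real.log (A.det * (1 + s * inner ℝ v u)) -
      ∑ i, w i * Real.log (inner ℝ (x i) (A (x i)) + s * (inner ℝ (x i) u) ^ 2)) 0 := by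
    filter_upwards [hpd] with s hs
    have := hmax _ hs
    simp only [logDetRatio, hdet, hform] at this
    simpa using this
  have hderiv : HasDerivAt (fun s : ℝ => Real.log (A.det * (1 + s * inner ℝ v u)) -
      ∑ i, w i * Real.log (inner ℝ (x i) (A (x i)) + s * (inner ℝ (x i) u) ^ 2))
      (inner ℝ v u - ∑ i, w i * ((inner ℝ (x i) u) ^ 2 / inner ℝ (x i) (A (x i)))) 0 := by
    refine HasDerivAt.sub ?_ (HasDerivAt.fun_sum fun i _ => HasDerivAt.const_mul _ ?_)
    · have h1 : HasDerivAt (fun s : ℝ => A.det * (1 + s * inner ℝ v u))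
          (A.det * (1 * inner ℝ v u)) 0 :=
        (((hasDerivAt_id 0).mul_const _).const_add 1).const_mul _
      have h2 := h1.log (by simpa using hA.det_pos.ne')
      have h3 := hA.det_pos.ne'
      convert! h2 using 1
      field_simp
      simp
    · have h1 : HasDerivAt (fun s : ℝ => inner ℝ (x i) (A (x i)) + s * (inner ℝ (x i) u) ^ 2)
          (1 * (inner ℝ (x i) u) ^ 2) 0 :=
        ((hasDerivAt_id 0).mul_const _).const_add _
      have h2 := h1.log (by simpa using (hq i).ne')
      simpa using h2
  have := hlocal.hasDerivAt_eq_zero hderiv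
  linarith

end Maximiser

/-! ### Splitting along tight subspaces and induction on dimension -/

section Induction

variable {ι : Type*} [Fintype ι]

/-- There is an inner product for which the weighted directions `x i` are isotropic. -/
def HasIsotropicForm {F : Type*} [AddCommGroup F] [Module ℝ F] (x : ι → F) (w : ι → ℝ) : Prop :=
  ∃ B : F →ₗ[ℝ] F →ₗ[ℝ] ℝ, (∀ u v, B u v = B v u) ∧ (∀ v, v ≠ 0 → 0 < B v v) ∧
    ∀ v, ∑ i, w i * ((B (x i) v) ^ 2 / B (x i) (x i)) = B v v

/-- Every subspace has weight at most its dimension, with equality only if the points split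
between the subspace and a complement. -/
def SubspaceCondition {F : Type*} [AddCommGroup F] [Module ℝ F] (x : ι → F) (w : ι → ℝ) : Prop :=
  ∀ V : Submodule ℝ F, weightIn x w V ≤ Module.finrank ℝ V ∧
    (weightIn x w V = Module.finrank ℝ V → ∃ W, IsCompl V W ∧ ∀ i, x i ∈ V ∨ x i ∈ W)

section Restriction

variable {F : Type*} [AddCommGroup F] [Module ℝ F]

open scoped Classical in
theorem weightIn_eq_sum_subtype (x : ι → F) (w : ι → ℝ) (V : Submodule ℝ F) :
    weightIn x w V = ∑ i : {i // x i ∈ V}, w i :=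
  Finset.sum_subtype _ (by simp) w

open scoped Classical in
theorem weightIn_restrict (x : ι → F) (w : ι → ℝ) (V : Submodule ℝ F) (U : Submodule ℝ V) :
    weightIn (fun i : {i // x i ∈ V} => (⟨x i, i.2⟩ : V)) (fun i => w i) U =
      weightIn x w (U.map V.subtype) := by
  have hmem : ∀ i : {i // x i ∈ V}, (⟨x i, i.2⟩ : V) ∈ U ↔ x i ∈ U.map V.subtype := by
    intro i
    rw [Submodule.mem_map]
    exact ⟨fun h => ⟨_, h, rfl⟩, fun ⟨y, hy, hyi⟩ => (Subtype.ext hyi : y = ⟨x i, i.2⟩) ▸ hy⟩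
  unfold weightIn
  rw [Finset.sum_filter, Finset.sum_filter,
    ← Finset.sum_filter_of_ne (p := fun i => x i ∈ V) (s := Finset.univ),
    Finset.sum_subtype (Finset.univ.filter fun i => x i ∈ V) (p := fun i => x i ∈ V) (by simp)]
  · exact Finset.sum_congr rfl fun i _ => if_congr (hmem i) rfl rfl
  · intro i _ hi
    obtain ⟨y, -, hyi⟩ := (ite_ne_right_iff.1 hi).1
    exact hyi ▸ y.2

-- A subspace tight in `V` is tight in the whole space; intersecting its complement there with `V`
-- gives a complement inside `V`.
open scoped Classical in
theorem SubspaceCondition.restrict {x : ι → F} {w : ι → ℝ} (h : SubspaceCondition x w)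
    (V : Submodule ℝ F) :
    SubspaceCondition (fun i : {i // x i ∈ V} => (⟨x i, i.2⟩ : V)) (fun i => w i) := by
  intro U
  have hfin : Module.finrank ℝ (U.map V.subtype) = Module.finrank ℝ U :=
    Submodule.finrank_map_subtype_eq V U
  rw [weightIn_restrict, ← hfin]
  refine ⟨(h _).1, fun heq => ?_⟩
  obtain ⟨W, hW, hx⟩ := (h _).2 heq
  refine ⟨W.comap V.subtype, ⟨?_, ?_⟩, fun i => ?_⟩
  · rw [Submodule.disjoint_def]
    intro v hv hvW
    exact Subtype.ext (Submodule.disjoint_def.1 hW.1 v (Submodule.mem_map_of_mem hv) hvW)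
  · rw [Submodule.codisjoint_iff_exists_add_eq]
    intro v
    obtain ⟨_, z, ⟨y, hy, rfl⟩, hz, hyz⟩ :=
      Submodule.codisjoint_iff_exists_add_eq.1 hW.2 (v : F)
    have hz' : z = ((v - y : V) : F) := by
      rw [Submodule.coe_sub, ← hyz]
      simp
    exact ⟨y, v - y, hy, by simpa [hz'] using hz, by simp⟩
  · refine (hx i).imp (fun hi => ?_) fun hi => hi
    obtain ⟨y, hy, hyi⟩ := hi
    exact (show y = (fun i : {i // x i ∈ V} => (⟨x i, i.2⟩ : V)) i from Subtype.ext hyi) ▸ hy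

open scoped Classical in
theorem sum_eq_sum_subtype_add_sum_subtype {x : ι → F} (hx : ∀ i, x i ≠ 0)
    {V W : Submodule ℝ F} (hVW : IsCompl V W) (hmem : ∀ i, x i ∈ V ∨ x i ∈ W) (f : ι → ℝ) :
    ∑ i, f i = ∑ i : {i // x i ∈ V}, f i + ∑ i : {i // x i ∈ W}, f i := by
  have h : ∀ i, ¬ x i ∈ V ↔ x i ∈ W := fun i =>
    ⟨fun hi => (hmem i).resolve_left hi,
      fun hi hV => hx i (Submodule.disjoint_def.1 hVW.1 _ hV hi)⟩
  rw [← Fintype.sum_subtype_add_sum_subtype (fun i => x i ∈ V) f]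
  congr 1
  exact Fintype.sum_equiv (Equiv.subtypeEquivRight h) _ _ fun _ => rfl

-- The direct sum of the two forms, pulled back along the projections, works: each point is killed
-- by one projection and fixed by the other, so the isotropy sum separates.
open scoped Classical in
theorem HasIsotropicForm.of_isCompl {x : ι → F} {w : ι → ℝ} (hx : ∀ i, x i ≠ 0)
    {V W : Submodule ℝ F} (hVW : IsCompl V W) (hmem : ∀ i, x i ∈ V ∨ x i ∈ W)
    (hV : HasIsotropicForm (fun i : {i // x i ∈ V} => (⟨x i, i.2⟩ : V)) (fun i => w i))
    (hW : HasIsotropicForm (fun i : {i // x i ∈ W} => (⟨x i, i.2⟩ : W)) (fun i => w i)) :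
    HasIsotropicForm x w := by
  obtain ⟨B₁, hs₁, hp₁, hi₁⟩ := hV
  obtain ⟨B₂, hs₂, hp₂, hi₂⟩ := hW
  set p := V.projectionOnto W hVW
  set q := W.projectionOnto V hVW.symm
  have hpV : ∀ y : V, p y = y := fun y => Submodule.projectionOnto_apply_left hVW y
  have hqW : ∀ y : W, q y = y := fun y => Submodule.projectionOnto_apply_left hVW.symm y
  have hpW : ∀ y : W, p y = 0 := fun y => Submodule.projectionOnto_apply_right hVW y
  have hqV : ∀ y : V, q y = 0 := fun y => Submodule.projectionOnto_apply_right hVW.symm y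
  have hnn₁ : ∀ y, 0 ≤ B₁ y y := fun y => by
    rcases eq_or_ne y 0 with rfl | h
    · simp
    · exact (hp₁ y h).le
  have hnn₂ : ∀ y, 0 ≤ B₂ y y := fun y => by
    rcases eq_or_ne y 0 with rfl | h
    · simp
    · exact (hp₂ y h).le
  refine ⟨B₁.compl₁₂ p p + B₂.compl₁₂ q q, fun u v => ?_, fun v hv => ?_, fun v => ?_⟩
  · simp [hs₁ (p u), hs₂ (q u)]
  · simp only [LinearMap.add_apply, LinearMap.compl₁₂_apply]
    by_cases hpv : p v = 0
    · have hqv : q v ≠ 0 := by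
        intro hqv
        apply hv
        have h1 : v ∈ W := by simpa [p] using hpv
        have h2 : v ∈ V := by simpa [q] using hqv
        exact Submodule.disjoint_def.1 hVW.1 v h2 h1
      exact add_pos_of_nonneg_of_pos (hnn₁ _) (hp₂ _ hqv)
    · exact add_pos_of_pos_of_nonneg (hp₁ _ hpv) (hnn₂ _)
  · rw [sum_eq_sum_subtype_add_sum_subtype hx hVW hmem]
    have h1 := hi₁ (p v)
    have h2 := hi₂ (q v)
    simp only [LinearMap.add_apply, LinearMap.compl₁₂_apply]
    rw [← h1, ← h2]
    congr 1
    · refine Finset.sum_congr rfl fun i _ => ?_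
      have e1 := hpV ⟨x i, i.2⟩
      have e2 := hqV ⟨x i, i.2⟩
      dsimp only at e1 e2
      simp [e1, e2]
    · refine Finset.sum_congr rfl fun i _ => ?_
      have e1 := hpW ⟨x i, i.2⟩
      have e2 := hqW ⟨x i, i.2⟩
      dsimp only at e1 e2
      simp [e1, e2]

end Restriction

theorem hasIsotropicForm_of_strict {E : Type*} [NormedAddCommGroup E] [InnerProductSpace ℝ E]
    [FiniteDimensional ℝ E] {x : ι → E} {w : ι → ℝ} (hx : ∀ i, ‖x i‖ = 1) (hw : ∀ i, 0 < w i)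
    (hsum : ∑ i, w i = Module.finrank ℝ E)
    (hV : ∀ V : Submodule ℝ E, V ≠ ⊥ → V ≠ ⊤ → weightIn x w V < Module.finrank ℝ V) :
    HasIsotropicForm x w := by
  rcases hn : Module.finrank ℝ E with _ | m
  · have := Module.finrank_zero_iff.1 hn
    exact ⟨0, by simp, fun v hv => absurd (Subsingleton.elim v 0) hv, by simp⟩
  · obtain ⟨r, hr, A, hA, hAr, hmax⟩ := exists_maximiser hn hx hw hsum hV
    refine ⟨(innerₗ E).compl₂ (A : E →ₗ[ℝ] E), fun u v => ?_, hA.2,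
      sum_inner_sq_div_eq_of_isMax hx hA hr hAr hmax⟩
    have := hA.1 v u
    simp only [ContinuousLinearMap.coe_coe] at this
    simp [← this, real_inner_comm]

/-- Under the subspace condition the points become isotropic for a suitable inner product. -/
theorem SubspaceCondition.hasIsotropicForm {E : Type*} [NormedAddCommGroup E]
    [InnerProductSpace ℝ E] [FiniteDimensional ℝ E] {x : ι → E} {w : ι → ℝ}
    (h : SubspaceCondition x w) (hx : ∀ i, ‖x i‖ = 1) (hw : ∀ i, 0 < w i)
    (hsum : ∑ i, w i = Module.finrank ℝ E) : HasIsotropicForm x w := by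
  classical
  induction hn : Module.finrank ℝ E using Nat.strong_induction_on generalizing E ι with
  | _ n ih =>
  by_cases hstrict : ∀ V : Submodule ℝ E, V ≠ ⊥ → V ≠ ⊤ → weightIn x w V < Module.finrank ℝ V
  · exact hasIsotropicForm_of_strict hx hw hsum hstrict
  push Not at hstrict
  obtain ⟨V, hbot, htop, hle⟩ := hstrict
  have heq : weightIn x w V = Module.finrank ℝ V := le_antisymm (h V).1 hle
  obtain ⟨W, hVW, hmem⟩ := (h V).2 heq
  have hx0 : ∀ i, x i ≠ 0 := fun i => norm_ne_zero_iff.1 (by simp [hx])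
  have hfin := Submodule.finrank_add_eq_of_isCompl hVW
  have hWtop : W ≠ ⊤ := fun hW => hbot (by simpa [hW] using hVW.inf_eq_bot)
  have h1 := Submodule.finrank_lt htop
  have h2 := Submodule.finrank_lt hWtop
  have hsumW : ∑ i : {i // x i ∈ W}, w i = Module.finrank ℝ W := by
    have := sum_eq_sum_subtype_add_sum_subtype hx0 hVW hmem w
    rw [← weightIn_eq_sum_subtype, heq, hsum, ← hfin] at this
    push_cast at this
    linarith
  refine HasIsotropicForm.of_isCompl hx0 hVW hmem ?_ ?_
  · exact ih _ (hn ▸ h1) (h.restrict V) (fun i => hx i) (fun i => hw i)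
      ((weightIn_eq_sum_subtype x w V).symm.trans heq) rfl
  · exact ih _ (hn ▸ h2) (h.restrict W) (fun i => hx i) (fun i => hw i) hsumW rfl

end Induction

/-- A positive definite form on a space linearly isomorphic to Euclidean space is the pullback of
the Euclidean inner product. -/
theorem exists_linearEquiv_inner_eq {F : Type*} [AddCommGroup F] [Module ℝ F]
    [FiniteDimensional ℝ F] {d : ℕ} (hd : Module.finrank ℝ F = d) (B : F →ₗ[ℝ] F →ₗ[ℝ] ℝ)
    (hs : ∀ u v, B u v = B v u) (hp : ∀ v, v ≠ 0 → 0 < B v v) :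
    ∃ T : F ≃ₗ[ℝ] EuclideanSpace ℝ (Fin d), ∀ u v, inner ℝ (T u) (T v) = B u v := by
  have hnn : ∀ y, 0 ≤ B y y := fun y => by
    rcases eq_or_ne y 0 with rfl | h
    · simp
    · exact (hp y h).le
  let core : InnerProductSpace.Core ℝ F :=
    { inner := fun u v => B u v
      conj_inner_symm := fun u v => by simp [hs u v]
      re_inner_nonneg := fun v => by simpa using hnn v
      add_left := fun u v z => by simp
      smul_left := fun u v r => by simp
      definite := fun v hv => by
        by_contra h
        exact (hp v h).ne' hv }
  let _ : NormedAddCommGroup F := core.toNormedAddCommGroup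
  let _ : InnerProductSpace ℝ F := InnerProductSpace.ofCore core.toCore
  refine ⟨((stdOrthonormalBasis ℝ F).reindex (finCongr hd)).repr.toLinearEquiv, fun u v => ?_⟩
  exact LinearIsometryEquiv.inner_map_map _ u v

/-! ### Translation between weighted pairs and isotropic forms; necessity of the condition -/

section Pairs

variable {d : ℕ}

theorem WeightedPair.transform_isIsotropic_iff (P : WeightedPair d)
    (T : EuclideanSpace ℝ (Fin d) ≃ₗ[ℝ] EuclideanSpace ℝ (Fin d)) :
    (P.transform T).IsIsotropic ↔ ∀ v, v ≠ 0 →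
      ∑ x ∈ P.X, P.μ x * ((inner ℝ (T x) v) ^ 2 / ‖T x‖ ^ 2 / ‖v‖ ^ 2) = 1 / (d : ℝ) := by
  classical
  have h : ∀ v, ∑ y ∈ (P.transform T).X, (P.transform T).μ y * ((inner ℝ y v) ^ 2 / ‖v‖ ^ 2) =
      ∑ x ∈ P.X, P.μ x * ((inner ℝ (T x) v) ^ 2 / ‖T x‖ ^ 2 / ‖v‖ ^ 2) := by
    intro v
    have hX : (P.transform T).X = P.X.image (normalizedImage T) := by
      simp only [WeightedPair.transform]
    rw [hX, Finset.sum_image fun x hx y hy hxy =>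
      normalizedImage_inj T (P.norm_eq_one x hx) (P.norm_eq_one y hy) hxy]
    refine Finset.sum_congr rfl fun x hx => ?_
    rw [P.transform_mu T hx, normalizedImage, real_inner_smul_left, mul_pow, inv_pow]
    congr 2
    ring
  simp only [WeightedPair.IsIsotropic, h]

theorem mem_orthogonal_of_forall_inner_basis_eq_zero {E : Type*} [NormedAddCommGroup E]
    [InnerProductSpace ℝ E] {κ : Type*} [Fintype κ] {U : Submodule ℝ E}
    (b : OrthonormalBasis κ ℝ U) {y : E} (h : ∀ j, inner ℝ y (b j : E) = 0) : y ∈ Uᗮ := by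
  refine (Submodule.mem_orthogonal U y).2 fun u hu => ?_
  have h1 : u = ∑ j, b.repr ⟨u, hu⟩ j • (b j : E) := by
    have := congrArg (Subtype.val) (b.sum_repr ⟨u, hu⟩)
    simpa using this.symm
  rw [h1, sum_inner]
  exact Finset.sum_eq_zero fun j _ => by
    rw [real_inner_smul_left, real_inner_comm, h, mul_zero]

theorem WeightedPair.mass_eq_zero_iff (P : WeightedPair d) {S : Set (EuclideanSpace ℝ (Fin d))} :
    P.mass S = 0 ↔ ∀ x ∈ P.X, x ∈ S → P.μ x = 0 := by
  classical
  unfold WeightedPair.mass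
  rw [Finset.sum_eq_zero_iff_of_nonneg]
  · simp only [Finset.mem_filter, and_imp]
  · exact fun x hx => P.nonneg x (Finset.mem_filter.1 hx).1

/-- Points in isotropic position satisfy the subspace condition. -/
theorem WeightedPair.mass_lt_or_split_of_isIsotropic (P : WeightedPair d)
    (T : EuclideanSpace ℝ (Fin d) ≃ₗ[ℝ] EuclideanSpace ℝ (Fin d))
    (hT : (P.transform T).IsIsotropic) {k : ℕ}
    (V : Submodule ℝ (EuclideanSpace ℝ (Fin d))) (hV : Module.finrank ℝ V = k) :
    P.mass V < (k : ℝ) / d ∨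
      (P.mass V = (k : ℝ) / d ∧
        ∃ W : Submodule ℝ (EuclideanSpace ℝ (Fin d)), Module.finrank ℝ W = d - k ∧
          P.mass {x | x ∉ V ∧ x ∉ W} = 0) := by
  classical
  rw [P.transform_isIsotropic_iff] at hT
  set U := V.map (T : EuclideanSpace ℝ (Fin d) →ₗ[ℝ] EuclideanSpace ℝ (Fin d))
  have hU : Module.finrank ℝ U = k := by rw [← hV]; exact LinearEquiv.finrank_map_eq T V
  let b := stdOrthonormalBasis ℝ U
  -- The squared length of the projection of `T x / ‖T x‖` to `U`. For points of `P.X` it is 1 on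
  -- `V`, and it vanishes only if `T x ∈ Uᗮ`.
  let g : EuclideanSpace ℝ (Fin d) → ℝ :=
    fun x => (∑ j, (inner ℝ (T x) (b j : EuclideanSpace ℝ (Fin d))) ^ 2) / ‖T x‖ ^ 2
  have hb : ∀ j, ‖(b j : EuclideanSpace ℝ (Fin d))‖ = 1 := fun j => b.orthonormal.1 j
  have hg0 : ∀ x, 0 ≤ g x := fun x => by positivity
  have hT0 : ∀ x ∈ P.X, ‖T x‖ ≠ 0 := fun x hx => by
    have : x ≠ 0 := norm_ne_zero_iff.1 (by simp [P.norm_eq_one x hx])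
    simpa using this
  have hgsum : ∑ x ∈ P.X, P.μ x * g x = k / d := by
    have h1 : ∑ j, ∑ x ∈ P.X, P.μ x *
        ((inner ℝ (T x) (b j : EuclideanSpace ℝ (Fin d))) ^ 2 / ‖T x‖ ^ 2) =
        ∑ _j : Fin (Module.finrank ℝ U), 1 / (d : ℝ) := by
      refine Finset.sum_congr rfl fun j _ => ?_
      have := hT (b j) (norm_ne_zero_iff.1 (by simp [hb]))
      simpa only [hb, one_pow, div_one] using this
    rw [Finset.sum_comm] at h1
    simp only [← Finset.mul_sum, ← Finset.sum_div] at h1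
    rw [h1]
    simp [hU, div_eq_mul_inv]
  have hgV : ∀ x ∈ P.X, x ∈ V → g x = 1 := by
    intro x hx hxV
    have h1 := b.sum_sq_norm_inner_left ⟨T x, Submodule.mem_map_of_mem hxV⟩
    simp only [Real.norm_eq_abs, sq_abs, Submodule.coe_inner, Submodule.coe_norm] at h1
    simp only [g]
    rw [div_eq_one_iff_eq (pow_ne_zero 2 (hT0 x hx))]
    exact h1
  have hmass : P.mass V = ∑ x ∈ P.X with x ∈ V, P.μ x * g x := by
    unfold WeightedPair.mass
    refine Finset.sum_congr (by ext; simp) fun x hx => ?_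
    rw [Finset.mem_filter] at hx
    rw [hgV x hx.1 hx.2, mul_one]
  have hsplit := Finset.sum_filter_add_sum_filter_not P.X (fun x => x ∈ V) fun x => P.μ x * g x
  rw [← hmass, hgsum] at hsplit
  have hterm : ∀ x ∈ P.X.filter (fun x => x ∉ V), 0 ≤ P.μ x * g x := fun x hx =>
    mul_nonneg (P.nonneg x (Finset.mem_filter.1 hx).1) (hg0 x)
  have hrest := Finset.sum_nonneg hterm
  rcases hrest.lt_or_eq with hpos | h0
  · left
    linarith
  right
  refine ⟨by linarith, Uᗮ.comap (T : EuclideanSpace ℝ (Fin d) →ₗ[ℝ] EuclideanSpace ℝ (Fin d)),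
    ?_, ?_⟩
  · have h1 := U.finrank_add_finrank_orthogonal
    rw [finrank_euclideanSpace_fin, hU] at h1
    have h2 : Module.finrank ℝ
        (Uᗮ.comap (T : EuclideanSpace ℝ (Fin d) →ₗ[ℝ] EuclideanSpace ℝ (Fin d))) =
        Module.finrank ℝ Uᗮ := by
      rw [Submodule.comap_equiv_eq_map_symm]
      exact LinearEquiv.finrank_map_eq T.symm Uᗮ
    omega
  · rw [P.mass_eq_zero_iff]
    rintro x hx ⟨hxV, hxW⟩
    have h1 := (Finset.sum_eq_zero_iff_of_nonneg hterm).1 h0.symm x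
      (Finset.mem_filter.2 ⟨hx, hxV⟩)
    refine (mul_eq_zero.1 h1).resolve_right fun hg => hxW ?_
    rw [div_eq_zero_iff, or_iff_left (pow_ne_zero 2 (hT0 x hx)),
      Finset.sum_eq_zero_iff_of_nonneg fun _ _ => sq_nonneg _] at hg
    exact mem_orthogonal_of_forall_inner_basis_eq_zero b fun j =>
      pow_eq_zero_iff two_ne_zero |>.1 (hg j (Finset.mem_univ j))

theorem WeightedPair.mass_eq_one_of_forall_mem (P : WeightedPair d)
    {S : Set (EuclideanSpace ℝ (Fin d))} (h : ∀ x ∈ P.X, P.μ x ≠ 0 → x ∈ S) : P.mass S = 1 := by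
  classical
  rw [← P.sum_eq_one]
  unfold WeightedPair.mass
  exact Finset.sum_filter_of_ne h

theorem WeightedPair.dim_pos (P : WeightedPair d) : 0 < d := by
  rcases Nat.eq_zero_or_pos d with rfl | h
  · have h1 := P.sum_eq_one
    rw [Finset.sum_eq_zero fun x hx => ?_] at h1
    · exact absurd h1 zero_ne_one
    · have h2 := P.norm_eq_one x hx
      rw [Subsingleton.elim x 0, norm_zero] at h2
      exact absurd h2 zero_ne_one
  · exact h

open scoped Classical in
/-- The points of positive mass of a pair. -/
noncomputable abbrev WeightedPair.support (P : WeightedPair d) :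
    Finset (EuclideanSpace ℝ (Fin d)) :=
  P.X.filter fun x => P.μ x ≠ 0

theorem WeightedPair.sum_support (P : WeightedPair d) (f : EuclideanSpace ℝ (Fin d) → ℝ) :
    ∑ i : P.support, (d * P.μ i) * f i = d * ∑ x ∈ P.X, P.μ x * f x := by
  classical
  rw [Finset.sum_coe_sort P.support fun x => (d * P.μ x) * f x, Finset.mul_sum]
  have h : ∀ x ∈ P.X, d * P.μ x * f x ≠ 0 → P.μ x ≠ 0 := fun x _ hne h0 => hne (by simp [h0])
  rw [Finset.sum_filter_of_ne h]
  exact Finset.sum_congr rfl fun x _ => mul_assoc _ _ _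

theorem WeightedPair.weightIn_support (P : WeightedPair d)
    (V : Submodule ℝ (EuclideanSpace ℝ (Fin d))) :
    weightIn (fun i : P.support => (i : EuclideanSpace ℝ (Fin d))) (fun i => d * P.μ i) V =
      d * P.mass V := by
  classical
  have := P.sum_support fun x => if x ∈ V then 1 else 0
  simp only [mul_ite, mul_one, mul_zero] at this
  unfold weightIn WeightedPair.mass
  rw [Finset.sum_filter, Finset.sum_filter]
  simp only [SetLike.mem_coe]
  convert this

/-- Zero-mass points are dropped because the functional needs positive weights, and because `W` need
only contain the points of positive mass outside `V`. -/
theorem WeightedPair.subspaceCondition_support (P : WeightedPair d)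
    (h : ∀ k : ℕ, 0 < k → k < d → ∀ V : Submodule ℝ (EuclideanSpace ℝ (Fin d)),
      Module.finrank ℝ V = k →
        P.mass V < (k : ℝ) / d ∨
        (P.mass V = (k : ℝ) / d ∧
          ∃ W : Submodule ℝ (EuclideanSpace ℝ (Fin d)), Module.finrank ℝ W = d - k ∧
            P.mass {x | x ∉ V ∧ x ∉ W} = 0)) :
    SubspaceCondition (fun i : P.support => (i : EuclideanSpace ℝ (Fin d)))
      (fun i => d * P.μ i) := by
  classical
  have hd : (0 : ℝ) < d := by exact_mod_cast P.dim_pos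
  have hE : Module.finrank ℝ (EuclideanSpace ℝ (Fin d)) = d := finrank_euclideanSpace_fin
  intro V
  rw [P.weightIn_support]
  rcases eq_or_ne V ⊥ with rfl | hbot
  · have h0 : P.mass ((⊥ : Submodule ℝ (EuclideanSpace ℝ (Fin d))) : Set _) = 0 := by
      refine P.mass_eq_zero_iff.2 fun x hx hx0 => ?_
      have h1 := P.norm_eq_one x hx
      rw [(Submodule.mem_bot ℝ).1 hx0, norm_zero] at h1
      exact absurd h1 zero_ne_one
    simp only [h0, finrank_bot]
    exact ⟨by simp, fun _ => ⟨⊤, isCompl_bot_top, fun i => Or.inr trivial⟩⟩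
  rcases eq_or_ne V ⊤ with rfl | htop
  · have h1 : P.mass ((⊤ : Submodule ℝ (EuclideanSpace ℝ (Fin d))) : Set _) = 1 :=
      P.mass_eq_one_of_forall_mem fun _ _ _ => trivial
    rw [h1, finrank_top, hE]
    exact ⟨by simp, fun _ => ⟨⊥, isCompl_top_bot, fun i => Or.inl trivial⟩⟩
  have hpos : 0 < Module.finrank ℝ V :=
    Nat.pos_of_ne_zero fun h0 => hbot (Submodule.finrank_eq_zero.1 h0)
  have hlt : Module.finrank ℝ V < d :=
    (Submodule.finrank_lt htop).trans_eq hE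
  rcases h _ hpos hlt V rfl with h1 | ⟨h1, W, hW, hmass⟩
  · rw [lt_div_iff₀ hd, mul_comm] at h1
    exact ⟨h1.le, fun h2 => absurd h2 h1.ne⟩
  · refine ⟨by rw [h1, mul_div_cancel₀ _ hd.ne'], fun _ => ⟨W, ?_, ?_⟩⟩
    all_goals
      have hmem : ∀ x ∈ P.X, P.μ x ≠ 0 → x ∈ V ∨ x ∈ W := by
        intro x hx hμ
        by_contra! hnot
        exact hμ (P.mass_eq_zero_iff.1 hmass x hx hnot)
    -- Only the dimension of `W` is given. But `V ⊔ W` carries mass 1, so if it were proper it would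
    -- violate the hypothesis; dimensions then force a complement.
    · have hsup : V ⊔ W = ⊤ := by
        by_contra hne
        have hone : P.mass ((V ⊔ W : Submodule ℝ (EuclideanSpace ℝ (Fin d))) : Set _) = 1 :=
          P.mass_eq_one_of_forall_mem fun x hx hμ => (hmem x hx hμ).elim
            (fun hx => Submodule.mem_sup_left hx) fun hx => Submodule.mem_sup_right hx
        have hlt' : Module.finrank ℝ (V ⊔ W : Submodule ℝ (EuclideanSpace ℝ (Fin d))) < d := by
          have := Submodule.finrank_lt hne
          rwa [hE] at this
        have hpos' : 0 < Module.finrank ℝ (V ⊔ W : Submodule ℝ (EuclideanSpace ℝ (Fin d))) :=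
          hpos.trans_le (Submodule.finrank_mono le_sup_left)
        have hfrac : (Module.finrank ℝ (V ⊔ W : Submodule ℝ (EuclideanSpace ℝ (Fin d))) : ℝ) / d
            < 1 := by
          rw [div_lt_one hd]
          exact_mod_cast hlt'
        rcases h _ hpos' hlt' (V ⊔ W) rfl with h2 | ⟨h2, -⟩ <;> linarith
      have h3 := Submodule.finrank_sup_add_finrank_inf_eq V W
      rw [hsup, finrank_top, hE] at h3
      exact ⟨disjoint_iff.2 (Submodule.finrank_eq_zero.1 (by omega)), codisjoint_iff.2 hsup⟩
    · exact fun i => hmem i (Finset.mem_filter.1 i.2).1 (Finset.mem_filter.1 i.2).2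

theorem WeightedPair.exists_transform_isIsotropic (P : WeightedPair d)
    (h : SubspaceCondition (fun i : P.support => (i : EuclideanSpace ℝ (Fin d)))
      (fun i => d * P.μ i)) :
    ∃ T : EuclideanSpace ℝ (Fin d) ≃ₗ[ℝ] EuclideanSpace ℝ (Fin d),
      (P.transform T).IsIsotropic := by
  classical
  have hd : (0 : ℝ) < d := by exact_mod_cast P.dim_pos
  have hE : Module.finrank ℝ (EuclideanSpace ℝ (Fin d)) = d := finrank_euclideanSpace_fin
  obtain ⟨B, hs, hp, hi⟩ := h.hasIsotropicForm
    (fun i => P.norm_eq_one i (Finset.mem_filter.1 i.2).1)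
    (fun i => mul_pos hd ((P.nonneg i (Finset.mem_filter.1 i.2).1).lt_of_ne
      (Finset.mem_filter.1 i.2).2.symm))
    (by simpa [P.sum_eq_one] using P.sum_support fun _ => 1)
  obtain ⟨T, hT⟩ := exists_linearEquiv_inner_eq hE B hs hp
  refine ⟨T, (P.transform_isIsotropic_iff T).2 fun v hv => ?_⟩
  -- At `v = T u` isotropy is the identity for `B` at `u`, divided by `d * B u u`.
  obtain ⟨u, rfl⟩ := T.surjective v
  have hnorm : ∀ z, ‖T z‖ ^ 2 = B z z := fun z => by rw [← real_inner_self_eq_norm_sq, hT]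
  have hu : 0 < B u u := hp u fun h0 => hv (by simp [h0])
  have h1 := hi u
  rw [P.sum_support fun x => (B x u) ^ 2 / B x x] at h1
  simp only [hT, hnorm, mul_div_assoc'] at h1 ⊢
  rw [← Finset.sum_div, div_eq_div_iff hu.ne' hd.ne']
  linarith

end Pairs

theorem mainTheorem5 (d : ℕ) (P : WeightedPair d) :
    (∃ T : EuclideanSpace ℝ (Fin d) ≃ₗ[ℝ] EuclideanSpace ℝ (Fin d),
      (P.transform T).IsIsotropic) ↔
    ∀ k : ℕ, 0 < k → k < d → ∀ V : Submodule ℝ (EuclideanSpace ℝ (Fin d)),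
      Module.finrank ℝ V = k →
        P.mass V < (k : ℝ) / d ∨
        (P.mass V = (k : ℝ) / d ∧
          ∃ W : Submodule ℝ (EuclideanSpace ℝ (Fin d)), Module.finrank ℝ W = d - k ∧
            P.mass {x | x ∉ V ∧ x ∉ W} = 0) := by
  constructor
  · rintro ⟨T, hT⟩ k - - V hV
    exact P.mass_lt_or_split_of_isIsotropic T hT V hV
  · exact fun h => P.exists_transform_isIsotropic (P.subspaceCondition_support h)
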